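/- Let $m\ge 2$, $q>1$, $T_1>0$, $T_j>(q-1)T_1$ for $j=2,\dots,m$, $y_0\in\mathbb R$, $b_j,c_j\in\mathbb R$ and $\alpha_j>0$ for $j=1,\dots,m$. Let $\Gamma_m$ be the star graph whose edge $e_1=[0,T_1]$ enters the internal vertex (at $t=T_1$) and whose edges $e_j=[0,T_j]$, $j=2,\dots,m$, leave it (at $t=0$). A function on $\Gamma_m$ is a tuple $y=[y_1,\dots,y_m]$ of real functions $y_j$ on $[0,T_j]$. Put $$l_1:=T_1,\qquad l_j:=q^{-1}\bigl(T_j-(q-1)T_1\bigr),\quad j=2,\dots,m,$$ $$W_2^k(\Gamma_m):=\bigoplus_{j=1}^m W_2^k[0,T_j],\qquad W_2^k(\widetilde\Gamma_m):=\bigoplus_{j=1}^m W_2^k[0,l_j],$$ where $y\in W_2^k(\widetilde\Gamma_m)$ refers to the restrictions of the components $y_j$ to $[0,l_j]$. For $y\in W_2^1(\Gamma_m)$ define $$\ell_1y(t)=y_1'(t)+b_1y_1(t)+c_1y_1(q^{-1}t),\quad 0<t<T_1,$$ $$\ell_jy(t)=y_j'(t)+b_jy_j(t)+c_jy_j\bigl(q^{-1}(t-(q-1)T_1)\bigr),\quad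 0<t<T_j,\ j=2,\dots,m,$$ where, for $j\ge2$, negative arguments are understood through the common history (the delay propagates through the internal vertex) $$y_j(t)=y_1(t+T_1),\quad (q^{-1}-1)T_1<t<0. \tag{H}$$ *Variational problem.* Minimize $$\mathcal J(y)=\sum_{j=1}^m\alpha_j\int_0^{T_j}(\ell_jy(t))^2\,dt$$ over all $y\in W_2^1(\Gamma_m)$ such that $$y_1(0)=y_0,\qquad y_j(0)=y_1(T_1),\qquad y_j(t)=0\ \text{ for } l_j\le t\le T_j,\qquad j=2,\dots,m. \tag{C}$$ *Boundary value problem $\mathcal B$.* The equations $$-\alpha_j(\ell_jy)'(t)+\alpha_jb_j\,\ell_jy(t)+\widetilde\ell_jy(t)=0\quad\text{for almost all } t\in(0,l_j),\quad j=1,\dots,m,$$ where $$\widetilde\ell_1y(t)=\begin{cases}q\,\alpha_1c_1\,\ell_1y(qt),&0<t<q^{-1}T_1,\\ q\sum_{k=2}^m\alpha_kc_k\,\ell_ky(qt-T_1),&q^{-1}T_1<t<T_1,\end{cases}$$ $$\widetilde\ell_jy(t)=q\,\alpha_jc_j\,\ell_jy\bigl(qt+(q-1)T_1\bigr),\quad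 0<t<l_j,\ j=2,\dots,m,$$ together with (H), (C) and the Kirchhoff-type condition $$\alpha_1y_1'(T_1)-\sum_{j=2}^m\alpha_jy_j'(0)+\beta\,y_1(T_1)+\gamma\,y_1(q^{-1}T_1)=0,$$ $$\beta:=\alpha_1b_1-\sum_{j=2}^m\alpha_jb_j,\qquad \gamma:=\alpha_1c_1-\sum_{j=2}^m\alpha_jc_j .$$ **Theorem.** A function $y\in W_2^1(\Gamma_m)$ is a solution of the variational problem if and only if $y\in W_2^2(\widetilde\Gamma_m)$ and $y$ is a solution of the boundary value problem $\mathcal B$. -/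

import Mathlib

open MeasureTheory Set

noncomputable section

/-- `MemW k a b f`: the restriction of `f` to `[a, b]` (where `a < b`) belongs to the real Sobolev
space `W_2^k[a, b]`, in the classical one-dimensional form: `f, f', …, f^(k-1)` are absolutely
continuous on `[a, b]` and `f^(k)` is square integrable on `(a, b)`. Derivatives are taken within
`[a, b]`, i.e. they are one-sided at the endpoints; values of `f` outside `[a, b]` are irrelevant. -/
def MemW : ℕ → ℝ → ℝ → (ℝ → ℝ) → Prop
  | 0, a, b, f => MemLp f 2 (volume.restrict (Ioo a b))
  | k + 1, a, b, f =>
      AbsolutelyContinuousOnInterval f a b ∧ MemW k a b (derivWithin f (Icc a b))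

/-- Data of the control system on the star graph with `m = n + 1` edges. The index `0` is the
incoming edge `e_1 = [0, T_1]`, the indices `j.succ` are the outgoing edges `e_2, …, e_m`;
the internal vertex is the end of the edge `0` and the beginning of every other edge. -/
structure PantographStar (n : ℕ) where
  /-- contraction parameter -/
  q : ℝ
  /-- edge lengths -/
  T : Fin (n + 1) → ℝ
  /-- coefficients at the undelayed term -/
  b : Fin (n + 1) → ℝ
  /-- coefficients at the delayed term -/
  c : Fin (n + 1) → ℝ
  /-- weights in the energy functional -/
  α : Fin (n + 1) → ℝ
  /-- initial value -/
  y₀ : ℝ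

namespace PantographStar

variable {n : ℕ}

/-- `T_1`, the length of the incoming edge. -/
def T₁ (S : PantographStar n) : ℝ := S.T 0

/-- The lengths `l_1 = T_1` and `l_j = q⁻¹ (T_j - (q - 1) T_1)` for the outgoing edges. -/
def l (S : PantographStar n) : Fin (n + 1) → ℝ :=
  Fin.cases S.T₁ fun j => S.q⁻¹ * (S.T j.succ - (S.q - 1) * S.T₁)

/-- The component on the outgoing edge `j`, prolonged to negative times through the internal
vertex by the common history: `y_j(s) = y_1(s + T_1)` for `s < 0`. -/
def withHistory (S : PantographStar n) (y : Fin (n + 1) → ℝ → ℝ) (j : Fin n) (s : ℝ) : ℝ :=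
  if s < 0 then y 0 (s + S.T₁) else y j.succ s

/-- The delayed term: `y_1(q⁻¹ t)` on the incoming edge and `y_j(q⁻¹ (t - (q - 1) T_1))` on the
outgoing ones. -/
def delayed (S : PantographStar n) (y : Fin (n + 1) → ℝ → ℝ) : Fin (n + 1) → ℝ → ℝ :=
  Fin.cases (fun t => y 0 (S.q⁻¹ * t))
    fun j t => S.withHistory y j (S.q⁻¹ * (t - (S.q - 1) * S.T₁))

/-- `ℓ_j y = y_j' + b_j y_j + c_j (delayed y_j)` on `[0, T_j]`. -/
def ell (S : PantographStar n) (y : Fin (n + 1) → ℝ → ℝ) (j : Fin (n + 1)) (t : ℝ) : ℝ :=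
  derivWithin (y j) (Icc 0 (S.T j)) t + S.b j * y j t + S.c j * S.delayed y j t

/-- The energy functional `J(y) = ∑_j α_j ∫_0^{T_j} (ℓ_j y)²`. -/
def energy (S : PantographStar n) (y : Fin (n + 1) → ℝ → ℝ) : ℝ :=
  ∑ j, S.α j * ∫ t in (0 : ℝ)..S.T j, S.ell y j t ^ 2

/-- `y ∈ W_2^k(Γ_m)`. -/
def MemWGraph (S : PantographStar n) (k : ℕ) (y : Fin (n + 1) → ℝ → ℝ) : Prop :=
  ∀ j, MemW k 0 (S.T j) (y j)

/-- `y ∈ W_2^k(Γ̃_m)`, the graph with edges `[0, l_j]`. -/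
def MemWReduced (S : PantographStar n) (k : ℕ) (y : Fin (n + 1) → ℝ → ℝ) : Prop :=
  ∀ j, MemW k 0 (S.l j) (y j)

/-- Initial condition `y_1(0) = y_0`, continuity at the internal vertex, and the damping condition
`y_j = 0` on `[l_j, T_j]` on the outgoing edges. -/
structure Admissible (S : PantographStar n) (y : Fin (n + 1) → ℝ → ℝ) : Prop where
  initial : y 0 0 = S.y₀
  continuous_vertex : ∀ j : Fin n, y j.succ 0 = y 0 S.T₁
  damped : ∀ j : Fin n, ∀ t ∈ Icc (S.l j.succ) (S.T j.succ), y j.succ t = 0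

/-- `y ∈ W_2^1(Γ_m)` solves the variational problem: it minimizes the energy among all functions
of `W_2^1(Γ_m)` subject to the same conditions. -/
def IsMinimizer (S : PantographStar n) (y : Fin (n + 1) → ℝ → ℝ) : Prop :=
  S.MemWGraph 1 y ∧ S.Admissible y ∧
    ∀ z : Fin (n + 1) → ℝ → ℝ, S.MemWGraph 1 z → S.Admissible z → S.energy y ≤ S.energy z

/-- The terms `ℓ̃_j y`. -/
def ellTilde (S : PantographStar n) (y : Fin (n + 1) → ℝ → ℝ) : Fin (n + 1) → ℝ → ℝ :=
  Fin.cases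
    (fun t =>
      if t < S.q⁻¹ * S.T₁ then S.q * S.α 0 * S.c 0 * S.ell y 0 (S.q * t)
      else S.q * ∑ k : Fin n, S.α k.succ * S.c k.succ * S.ell y k.succ (S.q * t - S.T₁))
    fun j t =>
      if t < S.l j.succ then
        S.q * S.α j.succ * S.c j.succ * S.ell y j.succ (S.q * t + (S.q - 1) * S.T₁)
      else 0

/-- `L_j y = -α_j (ℓ_j y)' + α_j b_j ℓ_j y + ℓ̃_j y`. -/
def operatorL (S : PantographStar n) (y : Fin (n + 1) → ℝ → ℝ) (j : Fin (n + 1)) (t : ℝ) : ℝ :=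
  -S.α j * deriv (S.ell y j) t + S.α j * S.b j * S.ell y j t + S.ellTilde y j t

/-- `β = α_1 b_1 - ∑_{j ≥ 2} α_j b_j`. -/
def β (S : PantographStar n) : ℝ := S.α 0 * S.b 0 - ∑ j : Fin n, S.α j.succ * S.b j.succ

/-- `γ = α_1 c_1 - ∑_{j ≥ 2} α_j c_j`. -/
def γ (S : PantographStar n) : ℝ := S.α 0 * S.c 0 - ∑ j : Fin n, S.α j.succ * S.c j.succ

/-- `y` solves the boundary value problem: the equations `L_j y = 0` hold almost everywhere on
`(0, l_j)`, together with the initial, continuity and damping conditions and the Kirchhoff-type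
condition at the internal vertex (endpoint derivatives are one-sided). For admissible
`y ∈ W_2^2(Γ̃_m)` every `ℓ_j y` is absolutely continuous on compact subintervals of `[0, l_j)`, so
that its derivative exists almost everywhere. -/
structure SolvesBVP (S : PantographStar n) (y : Fin (n + 1) → ℝ → ℝ) : Prop where
  equation : ∀ j, ∀ᵐ t ∂(volume.restrict (Ioo 0 (S.l j))), S.operatorL y j t = 0
  admissible : S.Admissible y
  kirchhoff :
    S.α 0 * derivWithin (y 0) (Icc 0 (S.T 0)) S.T₁
      - ∑ j : Fin n, S.α j.succ * derivWithin (y j.succ) (Icc 0 (S.T j.succ)) 0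
      + S.β * y 0 S.T₁ + S.γ * y 0 (S.q⁻¹ * S.T₁) = 0

end PantographStar

end

/-!
# Damping of a control system with pantograph delay on a star graph

The energy is a nonnegative quadratic functional, so an admissible `y` is a minimizer if and only if
the bilinear form `energyForm` vanishes on `(y, v)` for every variation `v`, i.e. for every `v`
satisfying the homogeneous constraints (`Proper.isMinimizer_iff`).

In `energyForm y v` the delayed arguments are moved from `v` to `ℓ y` by linear changes of variables.
The part of each outgoing edge on which the delayed argument is negative sees `v` through the common
history, so that it contributes to the incoming edge; this is how the two-case formula for `ℓ̃_1`
arises. The result is `Proper.energyForm_eq`: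
`energyForm y v = ∑ j, ∫_0^{l_j} (α_j ℓ_j y · v_j' + (α_j b_j ℓ_j y + ℓ̃_j y) · v_j)`.

Integrating the second term by parts and testing with variations whose derivatives are prescribed
gives the du Bois-Reymond lemma on the graph (`Proper.solvesIntegratedEuler_iff`): the form vanishes
on all variations if and only if `α_j ℓ_j y` is almost everywhere a primitive
`P_j = K_j + ∫_0^t (α_j b_j ℓ_j y + ℓ̃_j y)` with `P_1(T_1) = ∑_{j ≥ 2} P_j(0)`.

If this holds, `y_j' = α_j⁻¹ P_j - b_j y_j - c_j (delayed y)_j` almost everywhere. The delayed term is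
of class `W_2^1`, because the history is pasted continuously at the vertex, hence so is the right-hand
side, and the identity holds everywhere on `[0, l_j]` with one-sided derivatives. Thus `y` is in
`W_2^2` on the reduced graph, differentiating `P_j` gives the equations, and the balance of the
`P_j` at the vertex is the Kirchhoff condition (`Proper.kirchhoff_eq`). The steps can be reversed.

Throughout, `W_2^1` functions are handled as primitives of square integrable functions
(`HasL2Deriv`), where pasting and substitution are operations on integrals; the link with absolute
continuity is Lebesgue's fundamental theorem of calculus.
-/

/-! ### Square integrable functions on an interval -/

theorem intervalIntegrable_of_memLp_two {f : ℝ → ℝ} {a b : ℝ} (hab : a ≤ b)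
    (hf : MemLp f 2 (volume.restrict (Ioo a b))) : IntervalIntegrable f volume a b := by
  rw [intervalIntegrable_iff_integrableOn_Ioo_of_le hab]
  exact hf.integrable (by norm_num)

theorem intervalIntegrable_mul_of_memLp_two {f g : ℝ → ℝ} {a b : ℝ} (hab : a ≤ b)
    (hf : MemLp f 2 (volume.restrict (Ioo a b))) (hg : MemLp g 2 (volume.restrict (Ioo a b))) :
    IntervalIntegrable (fun t => f t * g t) volume a b := by
  rw [intervalIntegrable_iff_integrableOn_Ioo_of_le hab]
  exact hf.integrable_mul hg

theorem memLp_two_of_continuousOn_Icc {f : ℝ → ℝ} {a b : ℝ} (hf : ContinuousOn f (Icc a b)) :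
    MemLp f 2 (volume.restrict (Ioo a b)) := by
  obtain ⟨C, hC⟩ := isCompact_Icc.exists_bound_of_continuousOn hf
  refine MemLp.of_bound ((hf.mono Ioo_subset_Icc_self).aestronglyMeasurable measurableSet_Ioo) C ?_
  filter_upwards [ae_restrict_mem measurableSet_Ioo] with t ht using hC t (Ioo_subset_Icc_self ht)

theorem memLp_two_restrict_Ioo_mono {f : ℝ → ℝ} {a b c d : ℝ}
    (hf : MemLp f 2 (volume.restrict (Ioo a b))) (hac : a ≤ c) (hdb : d ≤ b) :
    MemLp f 2 (volume.restrict (Ioo c d)) :=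
  hf.mono_measure (Measure.restrict_mono (Ioo_subset_Ioo hac hdb) le_rfl)

theorem memLp_two_ite {f g : ℝ → ℝ} {a b c : ℝ}
    (hf : MemLp f 2 (volume.restrict (Ioo a c))) (hg : MemLp g 2 (volume.restrict (Ioo c b))) :
    MemLp (fun t => if t < c then f t else g t) 2 (volume.restrict (Ioo a b)) := by
  classical
  refine MemLp.piecewise (s := Iio c) measurableSet_Iio (hf.mono_measure ?_) (hg.mono_measure ?_)
  · rw [Measure.restrict_restrict measurableSet_Iio]
    refine Measure.restrict_mono ?_ le_rfl
    exact fun t ht => ⟨ht.2.1, ht.1⟩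
  · rw [Measure.restrict_restrict measurableSet_Iio.compl, Measure.restrict_congr_set
      (Ioo_ae_eq_Ico (a := c) (b := b))]
    refine Measure.restrict_mono ?_ le_rfl
    exact fun t ht => ⟨not_lt.1 ht.1, ht.2.2⟩

theorem memLp_two_comp_affine {f : ℝ → ℝ} {a b k d : ℝ} (hk : 0 < k)
    (hf : MemLp f 2 (volume.restrict (Ioo (k * a + d) (k * b + d)))) :
    MemLp (fun t => f (k * t + d)) 2 (volume.restrict (Ioo a b)) := by
  have hφ : Measurable fun t : ℝ => k * t + d := by fun_prop
  have hpre : (fun t : ℝ => k * t + d) ⁻¹' Ioo (k * a + d) (k * b + d) = Ioo a b := by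
    ext t; simp [hk]
  have hmap : Measure.map (fun t : ℝ => k * t + d) (volume.restrict (Ioo a b))
      = ENNReal.ofReal |k⁻¹| • volume.restrict (Ioo (k * a + d) (k * b + d)) := by
    rw [← hpre, ← Measure.restrict_map hφ measurableSet_Ioo, ← Measure.restrict_smul]
    congr 1
    have h₁ : Measure.map (fun t : ℝ => k * t + d) volume
        = Measure.map (· + d) (Measure.map (k * ·) volume) :=
      (Measure.map_map (measurable_add_const d) (measurable_const_mul k)).symm
    rw [h₁, Real.map_volume_mul_left hk.ne', Measure.map_smul, map_add_right_eq_self]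
  have h := hf.smul_measure (c := ENNReal.ofReal |k⁻¹|) (by simp)
  rw [← hmap] at h
  exact (memLp_map_measure_iff h.1 hφ.aemeasurable).1 h

theorem ae_eq_zero_of_integral_sq_eq_zero {f : ℝ → ℝ} {a b : ℝ} (hab : a ≤ b)
    (hf : MemLp f 2 (volume.restrict (Ioo a b))) (h : ∫ t in a..b, f t * f t = 0) :
    f =ᵐ[volume.restrict (Ioo a b)] 0 := by
  rw [intervalIntegral.integral_of_le hab, integral_Ioc_eq_integral_Ioo,
    integral_eq_zero_iff_of_nonneg (fun t => mul_self_nonneg _) (hf.integrable_mul hf)] at h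
  filter_upwards [h] with t ht using mul_self_eq_zero.1 ht

theorem intervalIntegral_congr_ae_Ioo {f g : ℝ → ℝ} {a b : ℝ} (hab : a ≤ b)
    (h : f =ᵐ[volume.restrict (Ioo a b)] g) : ∫ t in a..b, f t = ∫ t in a..b, g t := by
  rw [intervalIntegral.integral_of_le hab, intervalIntegral.integral_of_le hab,
    integral_Ioc_eq_integral_Ioo, integral_Ioc_eq_integral_Ioo]
  exact integral_congr_ae h

theorem ae_restrict_Ioo_mono {p : ℝ → Prop} {a b c d : ℝ} (hac : a ≤ c) (hdb : d ≤ b)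
    (h : ∀ᵐ t ∂(volume.restrict (Ioo a b)), p t) : ∀ᵐ t ∂(volume.restrict (Ioo c d)), p t :=
  ae_mono (Measure.restrict_mono (Ioo_subset_Ioo hac hdb) le_rfl) h

/-! ### One-dimensional Sobolev functions as primitives -/

/-- `g` is a square integrable weak derivative of `f` on `[a, b]`: `f` is a primitive of `g`.
The function `g` matters only up to null sets, which makes this form of `W_2^1[a, b]` stable under
pasting and changes of variables. -/
structure HasL2Deriv (f g : ℝ → ℝ) (a b : ℝ) : Prop where
  memLp : MemLp g 2 (volume.restrict (Ioo a b))
  eq_add_integral : ∀ t ∈ Icc a b, f t = f a + ∫ s in a..t, g s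

namespace HasL2Deriv

variable {f g f₁ g₁ f₂ g₂ : ℝ → ℝ} {a b c : ℝ}

theorem intervalIntegrable (h : HasL2Deriv f g a b) (hab : a ≤ b) :
    IntervalIntegrable g volume a b :=
  intervalIntegrable_of_memLp_two hab h.memLp

theorem intervalIntegrable_sub (h : HasL2Deriv f g a b) {s t : ℝ} (hs : s ∈ Icc a b)
    (ht : t ∈ Icc a b) : IntervalIntegrable g volume s t := by
  have hab : a ≤ b := hs.1.trans hs.2
  refine (h.intervalIntegrable hab).mono_set ?_
  rw [uIcc_of_le hab]
  exact uIcc_subset_Icc hs ht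

theorem sub_eq_integral (h : HasL2Deriv f g a b) {s t : ℝ} (hs : s ∈ Icc a b)
    (ht : t ∈ Icc a b) : f t - f s = ∫ r in s..t, g r := by
  have hab : a ≤ b := hs.1.trans hs.2
  have ha : a ∈ Icc a b := ⟨le_rfl, hab⟩
  rw [h.eq_add_integral t ht, h.eq_add_integral s hs, add_sub_add_left_eq_sub,
    intervalIntegral.integral_interval_sub_left (h.intervalIntegrable_sub ha ht)
      (h.intervalIntegrable_sub ha hs)]

theorem congr (h : HasL2Deriv f g a b) (hf : ∀ t ∈ Icc a b, f₁ t = f t) :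
    HasL2Deriv f₁ g a b := by
  refine ⟨h.memLp, fun t ht => ?_⟩
  rw [hf t ht, hf a ⟨le_rfl, ht.1.trans ht.2⟩, h.eq_add_integral t ht]

theorem congr_deriv (h : HasL2Deriv f g a b) (hg : g =ᵐ[volume.restrict (Ioo a b)] g₁) :
    HasL2Deriv f g₁ a b := by
  refine ⟨h.memLp.ae_eq hg, fun t ht => ?_⟩
  rw [h.eq_add_integral t ht, intervalIntegral_congr_ae_Ioo ht.1
    (ae_restrict_Ioo_mono le_rfl ht.2 hg)]

theorem mono (h : HasL2Deriv f g a b) {c d : ℝ} (hac : a ≤ c) (hdb : d ≤ b) :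
    HasL2Deriv f g c d := by
  refine ⟨memLp_two_restrict_Ioo_mono h.memLp hac hdb, fun t ht => ?_⟩
  rw [← h.sub_eq_integral (s := c) ⟨hac, ht.1.trans (ht.2.trans hdb)⟩
    ⟨hac.trans ht.1, ht.2.trans hdb⟩]
  ring

theorem primitive (hg : MemLp g 2 (volume.restrict (Ioo a b))) (k : ℝ) :
    HasL2Deriv (fun t => k + ∫ s in a..t, g s) g a b :=
  ⟨hg, fun t _ => by simp⟩

theorem absolutelyContinuousOnInterval (h : HasL2Deriv f g a b) (hab : a ≤ b) :
    AbsolutelyContinuousOnInterval f a b := by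
  have h₁ := (h.intervalIntegrable hab).absolutelyContinuousOnInterval_intervalIntegral
    (c := a) (by simp)
  have h₂ : AbsolutelyContinuousOnInterval (fun _ : ℝ => f a) a b :=
    (contDiffOn_const).absolutelyContinuousOnInterval
  have h₃ := h₂.add h₁
  rw [absolutelyContinuousOnInterval_iff] at h₃ ⊢
  intro ε hε
  obtain ⟨δ, hδ, H⟩ := h₃ ε hε
  refine ⟨δ, hδ, fun E hE hEδ => ?_⟩
  convert H E hE hEδ using 1
  refine Finset.sum_congr rfl fun i hi => ?_
  have := hE.1 i hi
  rw [uIcc_of_le hab] at this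
  simp only [Pi.add_apply]
  rw [← h.eq_add_integral _ this.1, ← h.eq_add_integral _ this.2]

theorem continuousOn (h : HasL2Deriv f g a b) : ContinuousOn f (Icc a b) := by
  rcases le_or_gt a b with hab | hab
  · rw [← uIcc_of_le hab]
    exact (h.absolutelyContinuousOnInterval hab).continuousOn
  · simp [Icc_eq_empty hab.not_ge]

theorem memLp_self (h : HasL2Deriv f g a b) : MemLp f 2 (volume.restrict (Ioo a b)) :=
  memLp_two_of_continuousOn_Icc h.continuousOn

theorem ae_hasDerivAt (h : HasL2Deriv f g a b) :
    ∀ᵐ t ∂(volume.restrict (Ioo a b)), HasDerivAt f (g t) t := by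
  rcases le_or_gt a b with hab | hab
  · have h₁ := (h.intervalIntegrable hab).ae_hasDerivAt_integral
    rw [ae_restrict_iff' measurableSet_Ioo]
    filter_upwards [h₁] with t ht htab
    have h₂ := (ht (by rw [uIcc_of_le hab]; exact Ioo_subset_Icc_self htab) a
      left_mem_uIcc).const_add (f a)
    refine h₂.congr_of_eventuallyEq ?_
    filter_upwards [Icc_mem_nhds htab.1 htab.2] with s hs using h.eq_add_integral s hs
  · simp [Ioo_eq_empty hab.not_gt]

theorem ae_eq_deriv (h : HasL2Deriv f g a b) : g =ᵐ[volume.restrict (Ioo a b)] deriv f := by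
  filter_upwards [h.ae_hasDerivAt] with t ht using ht.deriv.symm

theorem ae_eq_derivWithin (h : HasL2Deriv f g a b) :
    g =ᵐ[volume.restrict (Ioo a b)] derivWithin f (Icc a b) := by
  filter_upwards [h.ae_hasDerivAt, ae_restrict_mem measurableSet_Ioo] with t ht htab
  rw [derivWithin_of_mem_nhds (Icc_mem_nhds htab.1 htab.2), ht.deriv]

theorem add (h₁ : HasL2Deriv f₁ g₁ a b) (h₂ : HasL2Deriv f₂ g₂ a b) :
    HasL2Deriv (fun t => f₁ t + f₂ t) (fun t => g₁ t + g₂ t) a b := by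
  refine ⟨h₁.memLp.add h₂.memLp, fun t ht => ?_⟩
  have ha : a ∈ Icc a b := ⟨le_rfl, ht.1.trans ht.2⟩
  rw [intervalIntegral.integral_add (h₁.intervalIntegrable_sub ha ht)
    (h₂.intervalIntegrable_sub ha ht), h₁.eq_add_integral t ht, h₂.eq_add_integral t ht]
  ring

theorem const_mul (h : HasL2Deriv f g a b) (k : ℝ) :
    HasL2Deriv (fun t => k * f t) (fun t => k * g t) a b := by
  refine ⟨h.memLp.const_mul k, fun t ht => ?_⟩
  rw [intervalIntegral.integral_const_mul, h.eq_add_integral t ht]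
  ring

theorem comp_affine {k d : ℝ} (hk : 0 < k)
    (h : HasL2Deriv f g (k * a + d) (k * b + d)) :
    HasL2Deriv (fun t => f (k * t + d)) (fun t => k * g (k * t + d)) a b := by
  refine ⟨(memLp_two_comp_affine hk h.memLp).const_mul k, fun t ht => ?_⟩
  rw [intervalIntegral.integral_const_mul, ← smul_eq_mul (a := k) (b := ∫ _ in _.._, _),
    intervalIntegral.smul_integral_comp_mul_add]
  exact h.eq_add_integral _ ⟨by gcongr; exact ht.1, by gcongr; exact ht.2⟩

/-- Pasting at `c` two functions that agree there. -/
theorem ite (hac : a ≤ c) (hcb : c ≤ b) (h₁ : HasL2Deriv f₁ g₁ a c) (h₂ : HasL2Deriv f₂ g₂ c b)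
    (hc : f₁ c = f₂ c) :
    HasL2Deriv (fun t => if t < c then f₁ t else f₂ t) (fun t => if t < c then g₁ t else g₂ t)
      a b := by
  have hval : ∀ t ≤ c, (if t < c then f₁ t else f₂ t) = f₁ t := by
    intro t ht
    rcases ht.eq_or_lt with rfl | h
    · simp [hc]
    · simp [h]
  have hI : ∀ t ∈ Icc a c, ∫ s in a..t, (if s < c then g₁ s else g₂ s) = ∫ s in a..t, g₁ s := by
    intro t ht
    refine intervalIntegral.integral_congr_Ioo_of_le ht.1 fun s hs => ?_
    simp [hs.2.trans_le ht.2]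
  have hmem := memLp_two_ite h₁.memLp h₂.memLp
  refine ⟨hmem, fun t ht => ?_⟩
  rw [hval a hac]
  rcases le_total t c with htc | htc
  · rw [hval t htc, hI t ⟨ht.1, htc⟩, h₁.eq_add_integral t ⟨ht.1, htc⟩]
  · have hint := intervalIntegrable_of_memLp_two (hac.trans hcb) hmem
    rw [← intervalIntegral.integral_add_adjacent_intervals (b := c), hI c ⟨hac, le_rfl⟩,
      ← add_assoc, ← h₁.eq_add_integral c ⟨hac, le_rfl⟩, hc, if_neg (not_lt.2 htc),
      h₂.eq_add_integral t ⟨htc, ht.2⟩]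
    · congr 1
      refine intervalIntegral.integral_congr_Ioo_of_le htc fun s hs => ?_
      simp [hs.1.le]
    · exact hint.mono_set (by
        rw [uIcc_of_le hac, uIcc_of_le (hac.trans hcb)]; exact Icc_subset_Icc le_rfl hcb)
    · exact hint.mono_set (by
        rw [uIcc_of_le htc, uIcc_of_le (hac.trans hcb)]; exact Icc_subset_Icc hac ht.2)

theorem integral_by_parts (hab : a ≤ b) (h₁ : HasL2Deriv f₁ g₁ a b) (h₂ : HasL2Deriv f₂ g₂ a b) :
    ∫ t in a..b, (f₁ t * g₂ t + g₁ t * f₂ t) = f₁ b * f₂ b - f₁ a * f₂ a := by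
  rw [← (h₁.absolutelyContinuousOnInterval hab).integral_deriv_mul_eq_sub
    (h₂.absolutelyContinuousOnInterval hab)]
  refine intervalIntegral_congr_ae_Ioo hab ?_
  filter_upwards [h₁.ae_eq_deriv, h₂.ae_eq_deriv] with t ht₁ ht₂
  rw [ht₁, ht₂, add_comm]

theorem memW_one (h : HasL2Deriv f g a b) (hab : a ≤ b) : MemW 1 a b f :=
  ⟨h.absolutelyContinuousOnInterval hab, h.memLp.ae_eq h.ae_eq_derivWithin⟩

end HasL2Deriv

theorem MemW.hasL2Deriv {f : ℝ → ℝ} {a b : ℝ} (h : MemW 1 a b f) :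
    HasL2Deriv f (derivWithin f (Icc a b)) a b := by
  refine ⟨h.2, fun t ht => ?_⟩
  have hac : AbsolutelyContinuousOnInterval f a t := h.1.mono (by
    rw [uIcc_of_le ht.1, uIcc_of_le (ht.1.trans ht.2)]; exact Icc_subset_Icc le_rfl ht.2)
  have := hac.integral_deriv_eq_sub
  rw [← sub_eq_iff_eq_add', ← this]
  refine intervalIntegral.integral_congr_Ioo_of_le ht.1 fun s hs => ?_
  rw [derivWithin_of_mem_nhds (Icc_mem_nhds hs.1 (hs.2.trans_le ht.2))]

/-- A primitive of a continuous function is differentiable on the closed interval, endpoints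
included. -/
theorem HasL2Deriv.hasDerivWithinAt {f g : ℝ → ℝ} {a b : ℝ} (h : HasL2Deriv f g a b)
    (hg : ContinuousOn g (Icc a b)) {t : ℝ} (ht : t ∈ Icc a b) :
    HasDerivWithinAt f (g t) (Icc a b) t := by
  have hab : a ≤ b := ht.1.trans ht.2
  have : Fact (t ∈ Icc a b) := ⟨ht⟩
  have := intervalIntegral.integral_hasDerivWithinAt_right (s := Icc a b) (t := Icc a b)
    (h.intervalIntegrable_sub ⟨le_rfl, hab⟩ ht)
    (hg.stronglyMeasurableAtFilter_nhdsWithin measurableSet_Icc t) (hg t ht)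
  exact (this.const_add (f a)).congr (fun s hs => h.eq_add_integral s hs) (h.eq_add_integral t ht)

namespace PantographStar

variable {n : ℕ} {S : PantographStar n} {y v g : Fin (n + 1) → ℝ → ℝ}

/-! ### The delayed terms on the star graph -/

/-- Standing assumptions on the data of the control system. -/
structure Proper (S : PantographStar n) : Prop where
  one_lt_q : 1 < S.q
  T_zero_pos : 0 < S.T 0
  lt_T_succ : ∀ j : Fin n, (S.q - 1) * S.T 0 < S.T j.succ
  α_pos : ∀ j, 0 < S.α j

@[simp] theorem l_zero : S.l 0 = S.T 0 := rfl

theorem l_succ (j : Fin n) : S.l j.succ = S.q⁻¹ * (S.T j.succ - (S.q - 1) * S.T 0) := rfl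

namespace Proper

variable (hS : S.Proper)
include hS

theorem q_pos : 0 < S.q := one_pos.trans hS.one_lt_q

theorem inv_q_pos : 0 < S.q⁻¹ := inv_pos.2 hS.q_pos

theorem q_sub_one_mul_pos : 0 < (S.q - 1) * S.T 0 :=
  mul_pos (sub_pos.2 hS.one_lt_q) hS.T_zero_pos

theorem inv_q_mul_T_pos : 0 < S.q⁻¹ * S.T 0 := mul_pos hS.inv_q_pos hS.T_zero_pos

theorem inv_q_mul_T_lt : S.q⁻¹ * S.T 0 < S.T 0 :=
  mul_lt_of_lt_one_left hS.T_zero_pos (inv_lt_one_of_one_lt₀ hS.one_lt_q)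

theorem T_pos (j : Fin (n + 1)) : 0 < S.T j := by
  cases j using Fin.cases with
  | zero => exact hS.T_zero_pos
  | succ j => exact hS.q_sub_one_mul_pos.trans (hS.lt_T_succ j)

theorem l_pos (j : Fin (n + 1)) : 0 < S.l j := by
  cases j using Fin.cases with
  | zero => exact hS.T_zero_pos
  | succ j => exact mul_pos hS.inv_q_pos (sub_pos.2 (hS.lt_T_succ j))

theorem q_mul_l_succ (j : Fin n) : S.q * S.l j.succ + (S.q - 1) * S.T 0 = S.T j.succ := by
  rw [l_succ, mul_inv_cancel_left₀ hS.q_pos.ne', sub_add_cancel]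

theorem l_succ_lt (j : Fin n) : S.l j.succ < S.T j.succ := by
  have h₁ := hS.q_mul_l_succ j
  have h₂ := mul_pos (sub_pos.2 hS.one_lt_q) (hS.l_pos j.succ)
  have h₃ := hS.q_sub_one_mul_pos
  linarith

theorem l_le (j : Fin (n + 1)) : S.l j ≤ S.T j := by
  cases j using Fin.cases with
  | zero => exact le_rfl
  | succ j => exact (hS.l_succ_lt j).le

theorem delayed_succ (y : Fin (n + 1) → ℝ → ℝ) (j : Fin n) :
    S.delayed y j.succ = fun t => if t < (S.q - 1) * S.T 0 then y 0 (S.q⁻¹ * t + S.q⁻¹ * S.T 0)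
      else y j.succ (S.q⁻¹ * t + -(S.q⁻¹ * ((S.q - 1) * S.T 0))) := by
  funext t
  have hq := hS.q_pos.ne'
  have h₁ : S.q⁻¹ * (t - (S.q - 1) * S.T 0) < 0 ↔ t < (S.q - 1) * S.T 0 := by
    rw [inv_mul_lt_iff₀ hS.q_pos, mul_zero, sub_neg]
  have h₂ : S.q⁻¹ * (t - (S.q - 1) * S.T 0) + S.T 0 = S.q⁻¹ * t + S.q⁻¹ * S.T 0 := by
    field_simp
    ring
  change (if S.q⁻¹ * (t - (S.q - 1) * S.T 0) < 0 then
    y 0 (S.q⁻¹ * (t - (S.q - 1) * S.T 0) + S.T 0) else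
    y j.succ (S.q⁻¹ * (t - (S.q - 1) * S.T 0))) = _
  simp only [h₁, h₂]
  congr 2
  ring

/-- The delayed term of a `W_2^1` function that is continuous at the internal vertex is again of
class `W_2^1` on each edge: the history and the function itself are pasted continuously. -/
theorem hasL2Deriv_delayed (hg : ∀ j, HasL2Deriv (y j) (g j) 0 (S.T j))
    (hv : ∀ j : Fin n, y j.succ 0 = y 0 S.T₁) (j : Fin (n + 1)) :
    ∃ d, HasL2Deriv (S.delayed y j) d 0 (S.T j) := by
  have hq := hS.q_pos.ne'
  cases j using Fin.cases with
  | zero =>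
    have h : HasL2Deriv (y 0) (g 0) (S.q⁻¹ * 0 + 0) (S.q⁻¹ * S.T 0 + 0) := by
      simp only [mul_zero, add_zero]
      exact (hg 0).mono le_rfl hS.inv_q_mul_T_lt.le
    exact ⟨_, (h.comp_affine hS.inv_q_pos).congr fun t _ => by simp [delayed]⟩
  | succ j =>
    have h₁ : HasL2Deriv (y 0) (g 0) (S.q⁻¹ * 0 + S.q⁻¹ * S.T 0)
        (S.q⁻¹ * ((S.q - 1) * S.T 0) + S.q⁻¹ * S.T 0) := by
      refine (hg 0).mono (by simpa using hS.inv_q_mul_T_pos.le) (le_of_eq ?_)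
      field_simp
      ring
    have h₂ : HasL2Deriv (y j.succ) (g j.succ)
        (S.q⁻¹ * ((S.q - 1) * S.T 0) + -(S.q⁻¹ * ((S.q - 1) * S.T 0)))
        (S.q⁻¹ * S.T j.succ + -(S.q⁻¹ * ((S.q - 1) * S.T 0))) := by
      refine (hg j.succ).mono (by simp) (le_trans (le_of_eq ?_) (hS.l_le j.succ))
      rw [l_succ]
      ring
    refine ⟨_, ((h₁.comp_affine hS.inv_q_pos).ite hS.q_sub_one_mul_pos.le (hS.lt_T_succ j).le
      (h₂.comp_affine hS.inv_q_pos) ?_).congr fun t _ => by rw [hS.delayed_succ]⟩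
    rw [add_neg_cancel, hv j]
    congr 1
    change _ = S.T 0
    field_simp
    ring

theorem memLp_delayed (hg : ∀ j, HasL2Deriv (y j) (g j) 0 (S.T j))
    (hv : ∀ j : Fin n, y j.succ 0 = y 0 S.T₁) (j : Fin (n + 1)) :
    MemLp (S.delayed y j) 2 (volume.restrict (Ioo 0 (S.T j))) :=
  (hS.hasL2Deriv_delayed hg hv j).choose_spec.memLp_self

end Proper

theorem ell_ae_eq (hg : ∀ j, HasL2Deriv (y j) (g j) 0 (S.T j)) (j : Fin (n + 1)) :
    S.ell y j =ᵐ[volume.restrict (Ioo 0 (S.T j))]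
      fun t => g j t + S.b j * y j t + S.c j * S.delayed y j t := by
  filter_upwards [(hg j).ae_eq_derivWithin] with t ht
  rw [ell, ht]

namespace Proper

theorem memLp_ell (hS : S.Proper) (hg : ∀ j, HasL2Deriv (y j) (g j) 0 (S.T j))
    (hv : ∀ j : Fin n, y j.succ 0 = y 0 S.T₁) (j : Fin (n + 1)) :
    MemLp (S.ell y j) 2 (volume.restrict (Ioo 0 (S.T j))) :=
  (((hg j).memLp.add ((hg j).memLp_self.const_mul (S.b j))).add
    ((hS.memLp_delayed hg hv j).const_mul (S.c j))).ae_eq (ell_ae_eq hg j).symm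

theorem memLp_ellTilde (hS : S.Proper)
    (hf : ∀ j, MemLp (S.ell y j) 2 (volume.restrict (Ioo 0 (S.T j)))) (j : Fin (n + 1)) :
    MemLp (S.ellTilde y j) 2 (volume.restrict (Ioo 0 (S.l j))) := by
  have hq := hS.q_pos.ne'
  cases j using Fin.cases with
  | zero =>
    have h₁ : MemLp (fun t => S.ell y 0 (S.q * t + 0)) 2
        (volume.restrict (Ioo 0 (S.q⁻¹ * S.T 0))) := by
      refine memLp_two_comp_affine hS.q_pos ?_
      rw [mul_inv_cancel_left₀ hq]
      simpa using hf 0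
    have h₂ (k : Fin n) : MemLp (fun t => S.ell y k.succ (S.q * t + -S.T 0)) 2
        (volume.restrict (Ioo (S.q⁻¹ * S.T 0) (S.T 0))) := by
      refine memLp_two_comp_affine hS.q_pos (memLp_two_restrict_Ioo_mono (hf k.succ) ?_ ?_)
      · rw [mul_inv_cancel_left₀ hq, add_neg_cancel]
      · linarith [hS.lt_T_succ k]
    refine memLp_two_ite (c := S.q⁻¹ * S.T 0) ?_ ?_
    · simpa using h₁.const_mul (S.q * S.α 0 * S.c 0)
    · exact (memLp_finsetSum Finset.univ
        fun k _ => (h₂ k).const_mul (S.α k.succ * S.c k.succ)).const_mul S.q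
  | succ j =>
    have h₁ : MemLp (fun t => S.ell y j.succ (S.q * t + (S.q - 1) * S.T 0)) 2
        (volume.restrict (Ioo 0 (S.l j.succ))) := by
      refine memLp_two_comp_affine hS.q_pos (memLp_two_restrict_Ioo_mono (hf j.succ) ?_ ?_)
      · simpa using hS.q_sub_one_mul_pos.le
      · rw [hS.q_mul_l_succ]
    refine (h₁.const_mul (S.q * S.α j.succ * S.c j.succ)).ae_eq ?_
    filter_upwards [ae_restrict_mem measurableSet_Ioo] with t ht
    exact (if_pos ht.2).symm

end Proper

/-! ### The bilinear form of the energy and its adjoint form -/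

/-- The symmetric bilinear form whose quadratic form is the energy. -/
noncomputable def energyForm (S : PantographStar n) (y v : Fin (n + 1) → ℝ → ℝ) : ℝ :=
  ∑ j, S.α j * ∫ t in (0 : ℝ)..S.T j, S.ell y j t * S.ell v j t

/-- The terms of the equation on the edge `j` that multiply the test function itself rather than
its derivative in the weak formulation. -/
noncomputable def lowerOrder (S : PantographStar n) (y : Fin (n + 1) → ℝ → ℝ) (j : Fin (n + 1))
    (t : ℝ) : ℝ :=
  S.α j * S.b j * S.ell y j t + S.ellTilde y j t

namespace Proper

variable (hS : S.Proper)
include hS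

theorem memLp_lowerOrder
    (hf : ∀ j, MemLp (S.ell y j) 2 (volume.restrict (Ioo 0 (S.T j)))) (j : Fin (n + 1)) :
    MemLp (S.lowerOrder y j) 2 (volume.restrict (Ioo 0 (S.l j))) :=
  ((memLp_two_restrict_Ioo_mono (hf j) le_rfl (hS.l_le j)).const_mul _).add
    (hS.memLp_ellTilde hf j)

theorem integral_mul_ell {f : ℝ → ℝ} (j : Fin (n + 1))
    (hf : MemLp f 2 (volume.restrict (Ioo 0 (S.T j))))
    (hg : ∀ j, HasL2Deriv (v j) (g j) 0 (S.T j)) (hv : ∀ j : Fin n, v j.succ 0 = v 0 S.T₁) :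
    ∫ t in (0 : ℝ)..S.T j, f t * S.ell v j t
      = (∫ t in (0 : ℝ)..S.T j, f t * g j t) + S.b j * (∫ t in (0 : ℝ)..S.T j, f t * v j t)
        + S.c j * ∫ t in (0 : ℝ)..S.T j, f t * S.delayed v j t := by
  have hT := (hS.T_pos j).le
  have i₁ := intervalIntegrable_mul_of_memLp_two hT hf (hg j).memLp
  have i₂ := (intervalIntegrable_mul_of_memLp_two hT hf (hg j).memLp_self).const_mul (S.b j)
  have i₃ := (intervalIntegrable_mul_of_memLp_two hT hf (hS.memLp_delayed hg hv j)).const_mul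
    (S.c j)
  rw [← intervalIntegral.integral_const_mul, ← intervalIntegral.integral_const_mul,
    ← intervalIntegral.integral_add i₁ i₂, ← intervalIntegral.integral_add (i₁.add i₂) i₃]
  refine intervalIntegral_congr_ae_Ioo hT ?_
  filter_upwards [ell_ae_eq hg j] with t ht
  rw [ht]
  ring

theorem integral_mul_delayed_zero (f : ℝ → ℝ) :
    ∫ t in (0 : ℝ)..S.T 0, f t * S.delayed v 0 t
      = S.q * ∫ t in (0 : ℝ)..S.q⁻¹ * S.T 0, f (S.q * t) * v 0 t := by
  have hq := hS.q_pos.ne'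
  have h := intervalIntegral.smul_integral_comp_mul_add (a := 0) (b := S.q⁻¹ * S.T 0)
    (fun t => f t * v 0 (S.q⁻¹ * t)) S.q 0
  simp only [mul_zero, add_zero, mul_inv_cancel_left₀ hq, inv_mul_cancel_left₀ hq,
    smul_eq_mul] at h
  exact h.symm

/-- The integral over the outgoing edge splits at `(q - 1) T_1`, where the delayed argument changes
sign; the first part involves `v` on the incoming edge only. -/
theorem integral_mul_delayed_succ {f : ℝ → ℝ} (j : Fin n)
    (hf : MemLp f 2 (volume.restrict (Ioo 0 (S.T j.succ))))
    (hg : ∀ j, HasL2Deriv (v j) (g j) 0 (S.T j)) (hv : ∀ j : Fin n, v j.succ 0 = v 0 S.T₁) :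
    ∫ t in (0 : ℝ)..S.T j.succ, f t * S.delayed v j.succ t
      = S.q * (∫ t in (S.q⁻¹ * S.T 0)..S.T 0, f (S.q * t - S.T 0) * v 0 t)
        + S.q * ∫ t in (0 : ℝ)..S.l j.succ, f (S.q * t + (S.q - 1) * S.T 0) * v j.succ t := by
  have hq := hS.q_pos.ne'
  have h₀ := hS.q_sub_one_mul_pos.le
  have h₁ := (hS.lt_T_succ j).le
  have hint := intervalIntegrable_mul_of_memLp_two (hS.T_pos j.succ).le hf
    (hS.memLp_delayed hg hv j.succ)
  rw [← intervalIntegral.integral_add_adjacent_intervals (b := (S.q - 1) * S.T 0)]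
  · congr 1
    · have h := intervalIntegral.smul_integral_comp_mul_add (a := S.q⁻¹ * S.T 0) (b := S.T 0)
        (fun t => f t * v 0 (S.q⁻¹ * t + S.q⁻¹ * S.T 0)) S.q (-S.T 0)
      have e₁ : S.q * (S.q⁻¹ * S.T 0) + -S.T 0 = 0 := by
        rw [mul_inv_cancel_left₀ hq, add_neg_cancel]
      have e₂ : S.q * S.T 0 + -S.T 0 = (S.q - 1) * S.T 0 := by ring
      have e₃ (t : ℝ) : S.q⁻¹ * (S.q * t + -S.T 0) + S.q⁻¹ * S.T 0 = t := by
        field_simp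
        ring
      simp only [e₁, e₂, e₃, smul_eq_mul] at h
      simp only [← sub_eq_add_neg] at h
      rw [h]
      refine intervalIntegral.integral_congr_Ioo_of_le h₀ fun t ht => ?_
      simp only [hS.delayed_succ, if_pos ht.2]
    · have h := intervalIntegral.smul_integral_comp_mul_add (a := 0) (b := S.l j.succ)
        (fun t => f t * v j.succ (S.q⁻¹ * t + -(S.q⁻¹ * ((S.q - 1) * S.T 0)))) S.q
        ((S.q - 1) * S.T 0)
      have e₃ (t : ℝ) : S.q⁻¹ * (S.q * t + (S.q - 1) * S.T 0)
          + -(S.q⁻¹ * ((S.q - 1) * S.T 0)) = t := by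
        field_simp
        ring
      simp only [mul_zero, zero_add, hS.q_mul_l_succ, e₃, smul_eq_mul] at h
      rw [h]
      refine intervalIntegral.integral_congr_Ioo_of_le h₁ fun t ht => ?_
      simp only [hS.delayed_succ, if_neg (not_lt.2 ht.1.le)]
  · exact hint.mono_set (by
      rw [uIcc_of_le h₀, uIcc_of_le (h₀.trans h₁)]; exact Icc_subset_Icc le_rfl h₁)
  · exact hint.mono_set (by
      rw [uIcc_of_le h₁, uIcc_of_le (h₀.trans h₁)]; exact Icc_subset_Icc h₀ le_rfl)

theorem integral_ellTilde_zero_mul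
    (hf : ∀ j, MemLp (S.ell y j) 2 (volume.restrict (Ioo 0 (S.T j))))
    (hg : ∀ j, HasL2Deriv (v j) (g j) 0 (S.T j)) :
    ∫ t in (0 : ℝ)..S.T 0, S.ellTilde y 0 t * v 0 t
      = S.α 0 * S.c 0 * (S.q * ∫ t in (0 : ℝ)..S.q⁻¹ * S.T 0, S.ell y 0 (S.q * t) * v 0 t)
        + ∑ k : Fin n, S.α k.succ * S.c k.succ *
          (S.q * ∫ t in (S.q⁻¹ * S.T 0)..S.T 0, S.ell y k.succ (S.q * t - S.T 0) * v 0 t) := by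
  have hq := hS.q_pos.ne'
  have h₀ := hS.inv_q_mul_T_pos.le
  have h₁ := hS.inv_q_mul_T_lt.le
  have hint := intervalIntegrable_mul_of_memLp_two (hS.T_pos 0).le
    (hS.memLp_ellTilde hf 0) (hg 0).memLp_self
  have hk (k : Fin n) : IntervalIntegrable
      (fun t => S.ell y k.succ (S.q * t - S.T 0) * v 0 t) volume (S.q⁻¹ * S.T 0) (S.T 0) := by
    refine intervalIntegrable_mul_of_memLp_two h₁
      (memLp_two_comp_affine (d := -S.T 0) hS.q_pos
        (memLp_two_restrict_Ioo_mono (hf k.succ) ?_ ?_))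
      (memLp_two_restrict_Ioo_mono (hg 0).memLp_self h₀ le_rfl)
    · rw [mul_inv_cancel_left₀ hq, add_neg_cancel]
    · linarith [hS.lt_T_succ k]
  rw [← intervalIntegral.integral_add_adjacent_intervals (b := S.q⁻¹ * S.T 0)]
  · congr 1
    · rw [← mul_assoc, ← intervalIntegral.integral_const_mul]
      refine intervalIntegral.integral_congr_Ioo_of_le h₀ fun t ht => ?_
      have : S.ellTilde y 0 t = S.q * S.α 0 * S.c 0 * S.ell y 0 (S.q * t) := if_pos ht.2
      simp only [this]
      ring
    · have e (k : Fin n) (I : ℝ) : S.α k.succ * S.c k.succ * (S.q * I)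
          = S.α k.succ * S.c k.succ * S.q * I := (mul_assoc _ _ _).symm
      simp only [e]
      simp only [← intervalIntegral.integral_const_mul]
      rw [← intervalIntegral.integral_finsetSum fun k _ => (hk k).const_mul _]
      refine intervalIntegral.integral_congr_Ioo_of_le h₁ fun t ht => ?_
      have : S.ellTilde y 0 t = S.q * ∑ k : Fin n, S.α k.succ * S.c k.succ *
          S.ell y k.succ (S.q * t - S.T 0) := if_neg (not_lt.2 ht.1.le)
      simp only [this, Finset.mul_sum, Finset.sum_mul]
      refine Finset.sum_congr rfl fun k _ => ?_
      ring
  · exact hint.mono_set (by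
      rw [uIcc_of_le h₀, uIcc_of_le (h₀.trans h₁)]; exact Icc_subset_Icc le_rfl h₁)
  · exact hint.mono_set (by
      rw [uIcc_of_le h₁, uIcc_of_le (h₀.trans h₁)]; exact Icc_subset_Icc h₀ le_rfl)

/-- The energy form in adjoint form: after a change of variables in the delayed terms, which sends
the history part of each outgoing edge back to the incoming one, the test function enters only
through its values and derivative on the reduced edges `[0, l_j]`. -/
theorem energyForm_eq
    (hf : ∀ j, MemLp (S.ell y j) 2 (volume.restrict (Ioo 0 (S.T j))))
    (hg : ∀ j, HasL2Deriv (v j) (g j) 0 (S.T j)) (hv : ∀ j : Fin n, v j.succ 0 = v 0 S.T₁)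
    (hd : ∀ j : Fin n, ∀ t ∈ Icc (S.l j.succ) (S.T j.succ), v j.succ t = 0) :
    S.energyForm y v = ∑ j, ∫ t in (0 : ℝ)..S.l j,
      (S.α j * S.ell y j t * g j t + S.lowerOrder y j t * v j t) := by
  have hsplit (j : Fin (n + 1)) : ∫ t in (0 : ℝ)..S.l j,
      (S.α j * S.ell y j t * g j t + S.lowerOrder y j t * v j t)
      = S.α j * (∫ t in (0 : ℝ)..S.l j, S.ell y j t * g j t)
        + S.α j * S.b j * (∫ t in (0 : ℝ)..S.l j, S.ell y j t * v j t)
        + ∫ t in (0 : ℝ)..S.l j, S.ellTilde y j t * v j t := by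
    have hl := (hS.l_pos j).le
    have hfl := memLp_two_restrict_Ioo_mono (hf j) le_rfl (hS.l_le j)
    have hgl := (hg j).mono le_rfl (hS.l_le j)
    have i₁ := (intervalIntegrable_mul_of_memLp_two hl hfl hgl.memLp).const_mul (S.α j)
    have i₂ := (intervalIntegrable_mul_of_memLp_two hl hfl hgl.memLp_self).const_mul
      (S.α j * S.b j)
    have i₃ := intervalIntegrable_mul_of_memLp_two hl (hS.memLp_ellTilde hf j) hgl.memLp_self
    rw [← intervalIntegral.integral_const_mul, ← intervalIntegral.integral_const_mul,
      ← intervalIntegral.integral_add i₁ i₂, ← intervalIntegral.integral_add (i₁.add i₂) i₃]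
    refine intervalIntegral.integral_congr fun t _ => ?_
    simp only [lowerOrder]
    ring
  -- On `(l_j, T_j)` both the test function and its derivative vanish.
  have hcut (j : Fin n) :
      (∫ t in (0 : ℝ)..S.T j.succ, S.ell y j.succ t * g j.succ t)
        = (∫ t in (0 : ℝ)..S.l j.succ, S.ell y j.succ t * g j.succ t) ∧
      (∫ t in (0 : ℝ)..S.T j.succ, S.ell y j.succ t * v j.succ t)
        = ∫ t in (0 : ℝ)..S.l j.succ, S.ell y j.succ t * v j.succ t := by
    have hl := (hS.l_pos j.succ).le
    have hlT := hS.l_le j.succ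
    have hgz : g j.succ =ᵐ[volume.restrict (Ioo (S.l j.succ) (S.T j.succ))] 0 := by
      filter_upwards [((hg j.succ).mono hl le_rfl).ae_eq_deriv,
        ae_restrict_mem measurableSet_Ioo] with t ht hmem
      have : v j.succ =ᶠ[nhds t] fun _ => 0 := by
        filter_upwards [Icc_mem_nhds hmem.1 hmem.2] with s hs using hd j s hs
      rw [ht, this.deriv_eq, deriv_const, Pi.zero_apply]
    have key (w : ℝ → ℝ) (hw : MemLp w 2 (volume.restrict (Ioo 0 (S.T j.succ))))
        (hz : w =ᵐ[volume.restrict (Ioo (S.l j.succ) (S.T j.succ))] 0) :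
        (∫ t in (0 : ℝ)..S.T j.succ, S.ell y j.succ t * w t)
          = ∫ t in (0 : ℝ)..S.l j.succ, S.ell y j.succ t * w t := by
      have hint := intervalIntegrable_mul_of_memLp_two (hl.trans hlT) (hf j.succ) hw
      have h0 : ∫ t in S.l j.succ..S.T j.succ, S.ell y j.succ t * w t = 0 := by
        rw [← intervalIntegral.integral_zero (μ := volume) (a := S.l j.succ) (b := S.T j.succ)]
        refine intervalIntegral_congr_ae_Ioo hlT ?_
        filter_upwards [hz] with t ht
        rw [ht, Pi.zero_apply, mul_zero]
      rw [← intervalIntegral.integral_add_adjacent_intervals (b := S.l j.succ), h0, add_zero]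
      · exact hint.mono_set (by
          rw [uIcc_of_le hl, uIcc_of_le (hl.trans hlT)]; exact Icc_subset_Icc le_rfl hlT)
      · exact hint.mono_set (by
          rw [uIcc_of_le hlT, uIcc_of_le (hl.trans hlT)]; exact Icc_subset_Icc hl le_rfl)
    refine ⟨key _ (hg j.succ).memLp hgz, key _ (hg j.succ).memLp_self ?_⟩
    filter_upwards [ae_restrict_mem measurableSet_Ioo] with t ht
      using hd j t (Ioo_subset_Icc_self ht)
  have htilde (j : Fin n) : ∫ t in (0 : ℝ)..S.l j.succ, S.ellTilde y j.succ t * v j.succ t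
      = S.q * S.α j.succ * S.c j.succ * ∫ t in (0 : ℝ)..S.l j.succ,
        S.ell y j.succ (S.q * t + (S.q - 1) * S.T 0) * v j.succ t := by
    rw [← intervalIntegral.integral_const_mul]
    refine intervalIntegral.integral_congr_Ioo_of_le (hS.l_pos j.succ).le fun t ht => ?_
    have : S.ellTilde y j.succ t = S.q * S.α j.succ * S.c j.succ *
        S.ell y j.succ (S.q * t + (S.q - 1) * S.T 0) := if_pos ht.2
    simp only [this]
    ring
  simp only [energyForm, hsplit]
  simp only [fun j => hS.integral_mul_ell j (hf j) hg hv]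
  rw [Fin.sum_univ_succ, Fin.sum_univ_succ]
  simp only [fun j : Fin n => hS.integral_mul_delayed_succ j (hf j.succ) hg hv, htilde,
    fun j => (hcut j).1, fun j => (hcut j).2, l_zero]
  rw [hS.integral_mul_delayed_zero, hS.integral_ellTilde_zero_mul hf hg]
  rw [mul_add, mul_add, ← mul_assoc, ← mul_assoc, add_assoc, add_assoc, add_assoc, add_assoc,
    add_right_inj, add_right_inj, add_assoc, add_right_inj, ← Finset.sum_add_distrib]
  refine Finset.sum_congr rfl fun j _ => ?_
  ring

end Proper

end PantographStar

namespace PantographStar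

variable {n : ℕ} {S : PantographStar n} {y z v g gy : Fin (n + 1) → ℝ → ℝ}

/-! ### Minimizers and the weak formulation -/

/-- `v`, with edgewise weak derivative `g`, is an admissible variation: a `W_2^1` function subject
to the homogeneous form of the constraints. -/
structure IsVariation (S : PantographStar n) (v g : Fin (n + 1) → ℝ → ℝ) : Prop where
  hasL2Deriv : ∀ j, HasL2Deriv (v j) (g j) 0 (S.T j)
  initial : v 0 0 = 0
  continuous_vertex : ∀ j : Fin n, v j.succ 0 = v 0 S.T₁
  damped : ∀ j : Fin n, ∀ t ∈ Icc (S.l j.succ) (S.T j.succ), v j.succ t = 0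

theorem delayed_add_const_mul (y v : Fin (n + 1) → ℝ → ℝ) (ε : ℝ) (j : Fin (n + 1)) (t : ℝ) :
    S.delayed (fun i s => y i s + ε * v i s) j t = S.delayed y j t + ε * S.delayed v j t := by
  cases j using Fin.cases with
  | zero => rfl
  | succ j =>
    simp only [delayed, Fin.cases_succ, withHistory]
    split_ifs <;> rfl

theorem Proper.energy_nonneg (hS : S.Proper) (y : Fin (n + 1) → ℝ → ℝ) : 0 ≤ S.energy y :=
  Finset.sum_nonneg fun j _ => mul_nonneg (hS.α_pos j).le
    (intervalIntegral.integral_nonneg (hS.T_pos j).le fun _ _ => sq_nonneg _)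

theorem Proper.energy_add_const_mul (hS : S.Proper)
    (hy : ∀ j, HasL2Deriv (y j) (gy j) 0 (S.T j)) (hyv : ∀ j : Fin n, y j.succ 0 = y 0 S.T₁)
    (hv : S.IsVariation v g) (ε : ℝ) :
    S.energy (fun j t => y j t + ε * v j t)
      = S.energy y + 2 * ε * S.energyForm y v + ε ^ 2 * S.energy v := by
  simp only [energy, energyForm, Finset.mul_sum, ← Finset.sum_add_distrib]
  refine Finset.sum_congr rfl fun j _ => ?_
  have hT := (hS.T_pos j).le
  have my := hS.memLp_ell hy hyv j
  have mv := hS.memLp_ell hv.hasL2Deriv hv.continuous_vertex j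
  have i₁ := intervalIntegrable_mul_of_memLp_two hT my my
  have i₂ := (intervalIntegrable_mul_of_memLp_two hT my mv).const_mul (2 * ε)
  have i₃ := (intervalIntegrable_mul_of_memLp_two hT mv mv).const_mul (ε ^ 2)
  have key : ∫ t in (0 : ℝ)..S.T j, S.ell (fun j t => y j t + ε * v j t) j t ^ 2
      = (∫ t in (0 : ℝ)..S.T j, S.ell y j t * S.ell y j t)
        + 2 * ε * (∫ t in (0 : ℝ)..S.T j, S.ell y j t * S.ell v j t)
        + ε ^ 2 * ∫ t in (0 : ℝ)..S.T j, S.ell v j t * S.ell v j t := by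
    rw [← intervalIntegral.integral_const_mul, ← intervalIntegral.integral_const_mul,
      ← intervalIntegral.integral_add i₁ i₂, ← intervalIntegral.integral_add (i₁.add i₂) i₃]
    refine intervalIntegral_congr_ae_Ioo hT ?_
    filter_upwards [ell_ae_eq hy j, ell_ae_eq hv.hasL2Deriv j,
      ell_ae_eq (fun i => (hy i).add ((hv.hasL2Deriv i).const_mul ε)) j] with t h₁ h₂ h₃
    rw [h₁, h₂, h₃, delayed_add_const_mul]
    ring
  rw [key]
  simp only [sq]
  ring

/-- The first variation: since the energy is a nonnegative quadratic functional, minimality is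
equivalent to orthogonality to all admissible variations. -/
theorem Proper.isMinimizer_iff (hS : S.Proper) (hy : S.MemWGraph 1 y) (hya : S.Admissible y) :
    S.IsMinimizer y ↔ ∀ v g, S.IsVariation v g → S.energyForm y v = 0 := by
  have hy' := fun j => (hy j).hasL2Deriv
  constructor
  · rintro ⟨-, -, hmin⟩ v g hv
    have h (ε : ℝ) : 0 ≤ S.energy v * (ε * ε) + 2 * S.energyForm y v * ε + 0 := by
      have h₁ := hmin (fun j t => y j t + ε * v j t)
        (fun j => ((hy' j).add ((hv.hasL2Deriv j).const_mul ε)).memW_one (hS.T_pos j).le)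
        ⟨by rw [hya.initial, hv.initial, mul_zero, add_zero],
          fun j => by rw [hya.continuous_vertex, hv.continuous_vertex],
          fun j t ht => by rw [hya.damped j t ht, hv.damped j t ht, mul_zero, add_zero]⟩
      rw [hS.energy_add_const_mul hy' hya.continuous_vertex hv] at h₁
      linarith
    have hd := discrim_le_zero h
    rw [discrim, mul_zero, sub_zero] at hd
    have := pow_eq_zero_iff two_ne_zero |>.1 (le_antisymm hd (sq_nonneg _))
    linarith
  · intro h
    refine ⟨hy, hya, fun z hz hza => ?_⟩
    have hv : S.IsVariation (fun j t => z j t + -1 * y j t) _ :=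
      ⟨fun j => (hz j).hasL2Deriv.add ((hy' j).const_mul (-1)),
        by rw [hza.initial, hya.initial]; ring,
        fun j => by rw [hza.continuous_vertex, hya.continuous_vertex],
        fun j t ht => by rw [hza.damped j t ht, hya.damped j t ht]; ring⟩
    have h₁ := hS.energy_add_const_mul hy' hya.continuous_vertex hv 1
    have h₂ : (fun j t => y j t + 1 * (z j t + -1 * y j t)) = z := by
      funext j t
      ring
    rw [h₂, h _ _ hv] at h₁
    have := hS.energy_nonneg fun j t => z j t + -1 * y j t
    linarith

/-! ### The weak formulation and the integrated Euler equations -/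

/-- The Euler equations in integrated (du Bois-Reymond) form: on each reduced edge `α_j ℓ_j y` is
almost everywhere a primitive of the lower order terms, and at the internal vertex the value carried
in by the incoming edge equals the sum of those carried away by the outgoing ones. -/
def SolvesIntegratedEuler (S : PantographStar n) (y : Fin (n + 1) → ℝ → ℝ) : Prop :=
  ∃ K : Fin (n + 1) → ℝ,
    (∀ j, ∀ᵐ t ∂(volume.restrict (Ioo 0 (S.l j))),
      S.α j * S.ell y j t = K j + ∫ s in (0 : ℝ)..t, S.lowerOrder y j s) ∧
    K 0 + ∫ s in (0 : ℝ)..S.T 0, S.lowerOrder y 0 s = ∑ j : Fin n, K j.succ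

/-- Prescribed square integrable derivatives `u_j` on the reduced edges come from a variation as
soon as the total increment along each path through the internal vertex vanishes. -/
theorem Proper.exists_isVariation (hS : S.Proper) {u : Fin (n + 1) → ℝ → ℝ}
    (hu : ∀ j, MemLp (u j) 2 (volume.restrict (Ioo 0 (S.l j))))
    (hsum : ∀ j : Fin n, (∫ t in (0 : ℝ)..S.T 0, u 0 t) + ∫ t in (0 : ℝ)..S.l j.succ, u j.succ t
      = 0) :
    ∃ v g, S.IsVariation v g ∧ v 0 (S.T 0) = ∫ t in (0 : ℝ)..S.T 0, u 0 t ∧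
      ∀ j, ∀ t < S.l j, g j t = u j t := by
  let k : Fin (n + 1) → ℝ := Fin.cases 0 fun _ => ∫ t in (0 : ℝ)..S.T 0, u 0 t
  let w : Fin (n + 1) → ℝ → ℝ := fun j t => if t < S.l j then u j t else 0
  have hw (j) : MemLp (w j) 2 (volume.restrict (Ioo 0 (S.T j))) :=
    memLp_two_ite (hu j) MemLp.zero
  have hw0 (j) : ∀ t ∈ Icc (S.l j) (S.T j), ∫ s in (0 : ℝ)..t, w j s
      = ∫ s in (0 : ℝ)..S.l j, u j s := by
    intro t ht
    have hl := (hS.l_pos j).le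
    have hint := intervalIntegrable_of_memLp_two (hS.T_pos j).le (hw j)
    rw [← intervalIntegral.integral_add_adjacent_intervals (b := S.l j),
      intervalIntegral.integral_congr_Ioo_of_le (f := w j) (g := fun _ => 0) ht.1,
      intervalIntegral.integral_zero, add_zero]
    · exact intervalIntegral.integral_congr_Ioo_of_le hl fun s hs => if_pos hs.2
    · exact fun s hs => if_neg (not_lt.2 hs.1.le)
    · exact hint.mono_set (by
        rw [uIcc_of_le hl, uIcc_of_le (hS.T_pos j).le]; exact Icc_subset_Icc le_rfl (hS.l_le j))
    · exact hint.mono_set (by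
        rw [uIcc_of_le ht.1, uIcc_of_le (hS.T_pos j).le]; exact Icc_subset_Icc hl ht.2)
  have hv0 : (0 : ℝ) + ∫ s in (0 : ℝ)..S.T 0, w 0 s = ∫ t in (0 : ℝ)..S.T 0, u 0 t := by
    rw [zero_add]
    exact hw0 0 (S.T 0) ⟨le_rfl, le_rfl⟩
  refine ⟨fun j t => k j + ∫ s in (0 : ℝ)..t, w j s, w,
    ⟨fun j => .primitive (hw j) (k j), ?_, fun j => ?_, fun j t ht => ?_⟩, hv0,
    fun j t ht => if_pos ht⟩
  · simp [k]
  · simp only [intervalIntegral.integral_same, add_zero]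
    exact hv0.symm
  · rw [hw0 j.succ t ht]
    exact hsum j

/-- Integrating the lower order terms by parts; the boundary terms at `l_j` survive only on the
incoming edge. -/
theorem Proper.energyForm_eq_of_isVariation (hS : S.Proper)
    (hf : ∀ j, MemLp (S.ell y j) 2 (volume.restrict (Ioo 0 (S.T j)))) (hv : S.IsVariation v g) :
    S.energyForm y v = (∑ j, ∫ t in (0 : ℝ)..S.l j,
        (S.α j * S.ell y j t - ∫ s in (0 : ℝ)..t, S.lowerOrder y j s) * g j t)
      + (∫ s in (0 : ℝ)..S.T 0, S.lowerOrder y 0 s) * v 0 (S.T 0) := by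
  have hedge (j : Fin (n + 1)) : ∫ t in (0 : ℝ)..S.l j,
      (S.α j * S.ell y j t * g j t + S.lowerOrder y j t * v j t)
      = (∫ t in (0 : ℝ)..S.l j,
        (S.α j * S.ell y j t - ∫ s in (0 : ℝ)..t, S.lowerOrder y j s) * g j t)
        + (∫ s in (0 : ℝ)..S.l j, S.lowerOrder y j s) * v j (S.l j) := by
    have hl := (hS.l_pos j).le
    have hH := HasL2Deriv.primitive (hS.memLp_lowerOrder hf j) 0
    have hvl := (hv.hasL2Deriv j).mono le_rfl (hS.l_le j)
    have hω := ((memLp_two_restrict_Ioo_mono (hf j) le_rfl (hS.l_le j)).const_mul (S.α j)).sub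
      hH.memLp_self
    have hparts := HasL2Deriv.integral_by_parts hl hH hvl
    have i₁ := intervalIntegrable_mul_of_memLp_two hl hω hvl.memLp
    have i₂ := (intervalIntegrable_mul_of_memLp_two hl hH.memLp_self hvl.memLp).add
      (intervalIntegrable_mul_of_memLp_two hl hH.memLp hvl.memLp_self)
    simp only [zero_add, intervalIntegral.integral_same, zero_mul, sub_zero] at hparts i₁ i₂
    rw [← hparts, ← intervalIntegral.integral_add]
    · refine intervalIntegral.integral_congr fun t _ => ?_
      ring
    · simpa using i₁
    · exact i₂
  rw [hS.energyForm_eq hf hv.hasL2Deriv hv.continuous_vertex hv.damped]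
  simp only [hedge, Finset.sum_add_distrib]
  congr 1
  rw [Fin.sum_univ_succ, Finset.sum_eq_zero fun j _ => ?_, add_zero, l_zero]
  rw [hv.damped j _ ⟨le_rfl, hS.l_le j.succ⟩, mul_zero]

/-- The du Bois-Reymond lemma on the star graph. -/
theorem Proper.solvesIntegratedEuler_iff (hS : S.Proper)
    (hf : ∀ j, MemLp (S.ell y j) 2 (volume.restrict (Ioo 0 (S.T j)))) :
    S.SolvesIntegratedEuler y ↔ ∀ v g, S.IsVariation v g → S.energyForm y v = 0 := by
  constructor
  · rintro ⟨K, hK, hK0⟩ v g hv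
    have hedge (j : Fin (n + 1)) : ∫ t in (0 : ℝ)..S.l j,
        (S.α j * S.ell y j t - ∫ s in (0 : ℝ)..t, S.lowerOrder y j s) * g j t
        = K j * (v j (S.l j) - v j 0) := by
      rw [(hv.hasL2Deriv j).sub_eq_integral ⟨le_rfl, (hS.T_pos j).le⟩ ⟨(hS.l_pos j).le, hS.l_le j⟩,
        ← intervalIntegral.integral_const_mul]
      refine intervalIntegral_congr_ae_Ioo (hS.l_pos j).le ?_
      filter_upwards [hK j] with t ht
      rw [ht, add_sub_cancel_right]
    rw [hS.energyForm_eq_of_isVariation hf hv, Finset.sum_congr rfl fun j _ => hedge j,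
      Fin.sum_univ_succ, hv.initial, l_zero]
    have h (j : Fin n) : K j.succ * (v j.succ (S.l j.succ) - v j.succ 0)
        = -(K j.succ * v 0 (S.T 0)) := by
      rw [hv.damped j _ ⟨le_rfl, hS.l_le j.succ⟩, hv.continuous_vertex]
      change K j.succ * (0 - v 0 (S.T 0)) = _
      ring
    simp only [h, Finset.sum_neg_distrib, ← Finset.sum_mul]
    rw [← hK0]
    ring
  · intro hweak
    set ω : Fin (n + 1) → ℝ → ℝ := fun j t =>
      S.α j * S.ell y j t - ∫ s in (0 : ℝ)..t, S.lowerOrder y j s with hωdef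
    have hω (j) : MemLp (ω j) 2 (volume.restrict (Ioo 0 (S.l j))) := by
      have := (HasL2Deriv.primitive (hS.memLp_lowerOrder hf j) 0).memLp_self
      simp only [zero_add] at this
      exact ((memLp_two_restrict_Ioo_mono (hf j) le_rfl (hS.l_le j)).const_mul (S.α j)).sub this
    have hint (j) := intervalIntegrable_of_memLp_two (hS.l_pos j).le (hω j)
    have hconst (j : Fin (n + 1)) (k : ℝ) : MemLp (fun _ : ℝ => k) 2
        (volume.restrict (Ioo 0 (S.l j))) := memLp_two_of_continuousOn_Icc continuousOn_const
    have horth (u : Fin (n + 1) → ℝ → ℝ)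
        (hu : ∀ j, MemLp (u j) 2 (volume.restrict (Ioo 0 (S.l j))))
        (hsum : ∀ j : Fin n, (∫ t in (0 : ℝ)..S.T 0, u 0 t)
          + ∫ t in (0 : ℝ)..S.l j.succ, u j.succ t = 0) :
        (∑ j, ∫ t in (0 : ℝ)..S.l j, ω j t * u j t)
          + (∫ s in (0 : ℝ)..S.T 0, S.lowerOrder y 0 s) * (∫ t in (0 : ℝ)..S.T 0, u 0 t) = 0 := by
      obtain ⟨v, g, hv, hv0, hgu⟩ := hS.exists_isVariation hu hsum
      have h := hweak v g hv
      rw [hS.energyForm_eq_of_isVariation hf hv, hv0] at h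
      refine Eq.trans ?_ h
      congr 1
      refine Finset.sum_congr rfl fun j _ => ?_
      refine intervalIntegral.integral_congr_Ioo_of_le (hS.l_pos j).le fun t ht => ?_
      simp only [hωdef, hgu j t ht.2]
    let m : Fin (n + 1) → ℝ := fun j => (∫ t in (0 : ℝ)..S.l j, ω j t) * (S.l j)⁻¹
    have hmean (j) : ∫ t in (0 : ℝ)..S.l j, (ω j t - m j) = 0 := by
      rw [intervalIntegral.integral_sub (hint j) intervalIntegrable_const,
        intervalIntegral.integral_const, sub_zero, smul_eq_mul, mul_comm (S.l j),
        inv_mul_cancel_right₀ (hS.l_pos j).ne', sub_self]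
    refine ⟨m, fun j => ?_, ?_⟩
    · -- The variation with derivative `ω_j - m_j` on the edge `j` alone has a vanishing increment.
      have hmem (j) := (hω j).sub (hconst j (m j))
      let u : Fin (n + 1) → ℝ → ℝ := fun i t => if i = j then ω i t - m i else 0
      have hu0 (i) : ∫ t in (0 : ℝ)..S.l i, u i t = 0 := by
        by_cases h : i = j
        · simp only [u, if_pos h, hmean]
        · simp only [u, if_neg h, intervalIntegral.integral_zero]
      have hu (i) : MemLp (u i) 2 (volume.restrict (Ioo 0 (S.l i))) := by
        by_cases h : i = j
        · simp only [u, if_pos h]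
          exact hmem i
        · simp only [u, if_neg h]
          exact MemLp.zero'
      have hu00 : ∫ t in (0 : ℝ)..S.T 0, u 0 t = 0 := hu0 0
      have h := horth u hu fun i => by rw [hu00, hu0, add_zero]
      rw [hu00, mul_zero, add_zero, Finset.sum_eq_single j
        (fun i _ hij => by simp [u, hij]) (fun h => absurd (Finset.mem_univ j) h)] at h
      simp only [u, if_true] at h
      have hsq : ∫ t in (0 : ℝ)..S.l j, (ω j t - m j) * (ω j t - m j) = 0 := by
        have i₁ := intervalIntegrable_mul_of_memLp_two (hS.l_pos j).le (hω j) (hmem j)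
        have i₂ := (intervalIntegrable_of_memLp_two (hS.l_pos j).le (hmem j)).const_mul (m j)
        have := intervalIntegral.integral_sub i₁ i₂
        simp only [Pi.sub_apply] at this
        rw [h, intervalIntegral.integral_const_mul, hmean, mul_zero, sub_zero] at this
        refine Eq.trans (intervalIntegral.integral_congr fun t _ => ?_) this
        ring
      filter_upwards [ae_eq_zero_of_integral_sq_eq_zero (hS.l_pos j).le (hmem j) hsq] with t ht
      have : ω j t - m j = 0 := ht
      simp only [hωdef] at this
      linarith
    · -- The variation growing linearly to `1` at the vertex and then decaying linearly to `0`.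
      have hinv (j : Fin (n + 1)) : ∫ _ in (0 : ℝ)..S.l j, (S.l j)⁻¹ = 1 := by
        rw [intervalIntegral.integral_const, sub_zero, smul_eq_mul,
          mul_inv_cancel₀ (hS.l_pos j).ne']
      have h := horth (Fin.cases (fun _ => (S.l 0)⁻¹) fun j _ => -(S.l j.succ)⁻¹)
        (fun j => by
          cases j using Fin.cases with
          | zero => exact hconst 0 _
          | succ j => exact hconst j.succ _)
        (fun j => by
          have := hinv 0
          simp only [Fin.cases_zero, Fin.cases_succ, intervalIntegral.integral_neg, hinv j.succ]
          rw [l_zero] at this ⊢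
          rw [this, add_neg_cancel])
      rw [Fin.sum_univ_succ] at h
      have h0 := hinv 0
      simp only [Fin.cases_zero, Fin.cases_succ, intervalIntegral.integral_mul_const] at h
      rw [l_zero] at h0 h
      rw [h0] at h
      simp only [mul_neg, Finset.sum_neg_distrib] at h
      have hm0 : m 0 = (∫ t in (0 : ℝ)..S.T 0, ω 0 t) * (S.T 0)⁻¹ := rfl
      simp only [m] at hm0 ⊢
      rw [l_zero]
      linarith

/-! ### Regularity and the boundary value problem -/

/-- `ℓ_j y` with the derivative taken within the reduced edge `[0, l_j]`; it differs from `ℓ_j y` on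
`[0, l_j]` at most at the endpoint `l_j`, where `y_j` may have a corner. -/
noncomputable def ellReduced (S : PantographStar n) (y : Fin (n + 1) → ℝ → ℝ) (j : Fin (n + 1))
    (t : ℝ) : ℝ :=
  derivWithin (y j) (Icc 0 (S.l j)) t + S.b j * y j t + S.c j * S.delayed y j t

namespace Proper

variable (hS : S.Proper)
include hS

theorem derivWithin_eq (f : ℝ → ℝ) (j : Fin (n + 1)) {t : ℝ} (ht : t < S.l j) :
    derivWithin f (Icc 0 (S.T j)) t = derivWithin f (Icc 0 (S.l j)) t := by
  refine derivWithin_congr_set ?_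
  filter_upwards [Iio_mem_nhds ht] with s hs
  exact propext ⟨fun h => ⟨h.1, le_of_lt hs⟩, fun h => ⟨h.1, h.2.trans (hS.l_le j)⟩⟩

theorem ell_eq_ellReduced (y : Fin (n + 1) → ℝ → ℝ) (j : Fin (n + 1)) {t : ℝ} (ht : t < S.l j) :
    S.ell y j t = S.ellReduced y j t := by
  rw [ell, ellReduced, hS.derivWithin_eq (y j) j ht]

/-- The left-hand side of the Kirchhoff-type condition is the defect in the balance of `α_j ℓ_j y`
at the vertex: at time `0` the delayed term on every outgoing edge is the history value
`y_1(q⁻¹ T_1)`. -/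
theorem kirchhoff_eq (hyv : ∀ j : Fin n, y j.succ 0 = y 0 S.T₁) :
    S.α 0 * derivWithin (y 0) (Icc 0 (S.T 0)) S.T₁
      - ∑ j : Fin n, S.α j.succ * derivWithin (y j.succ) (Icc 0 (S.T j.succ)) 0
      + S.β * y 0 S.T₁ + S.γ * y 0 (S.q⁻¹ * S.T₁)
      = S.α 0 * S.ellReduced y 0 (S.T 0) - ∑ j : Fin n, S.α j.succ * S.ellReduced y j.succ 0 := by
  have h (j : Fin n) : S.α j.succ * S.ellReduced y j.succ 0
      = S.α j.succ * derivWithin (y j.succ) (Icc 0 (S.T j.succ)) 0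
        + S.α j.succ * S.b j.succ * y 0 S.T₁ + S.α j.succ * S.c j.succ * y 0 (S.q⁻¹ * S.T₁) := by
    have hd : S.delayed y j.succ 0 = y 0 (S.q⁻¹ * S.T₁) := by
      rw [hS.delayed_succ]
      beta_reduce
      rw [if_pos hS.q_sub_one_mul_pos, mul_zero, zero_add]
      rfl
    rw [ellReduced, hd, hyv, hS.derivWithin_eq _ _ (hS.l_pos j.succ)]
    ring
  simp only [h, Finset.sum_add_distrib, ← Finset.sum_mul]
  simp only [β, γ]
  change _ = S.α 0 * (derivWithin (y 0) (Icc 0 (S.T 0)) S.T₁ + S.b 0 * y 0 S.T₁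
    + S.c 0 * y 0 (S.q⁻¹ * S.T₁)) - _
  ring

theorem solvesBVP_of_solvesIntegratedEuler (hy : S.MemWGraph 1 y) (hya : S.Admissible y)
    (h : S.SolvesIntegratedEuler y) : S.MemWReduced 2 y ∧ S.SolvesBVP y := by
  obtain ⟨K, hK, hK0⟩ := h
  have hy' := fun j => (hy j).hasL2Deriv
  have hf := hS.memLp_ell hy' hya.continuous_vertex
  have hP (j) := HasL2Deriv.primitive (hS.memLp_lowerOrder hf j) (K j)
  set P : Fin (n + 1) → ℝ → ℝ := fun j t => K j + ∫ s in (0 : ℝ)..t, S.lowerOrder y j s with hPdef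
  let r : Fin (n + 1) → ℝ → ℝ := fun j t =>
    (S.α j)⁻¹ * P j t + (-S.b j * y j t + -S.c j * S.delayed y j t)
  have hr (j) : ∃ d, HasL2Deriv (r j) d 0 (S.l j) := by
    obtain ⟨d, hd⟩ := hS.hasL2Deriv_delayed hy' hya.continuous_vertex j
    exact ⟨_, ((hP j).const_mul _).add ((((hy' j).mono le_rfl (hS.l_le j)).const_mul _).add
      ((hd.mono le_rfl (hS.l_le j)).const_mul _))⟩
  -- The weak derivative of `y_j` agrees almost everywhere with a function of class `W_2^1`.
  have hyr (j) : HasL2Deriv (y j) (r j) 0 (S.l j) := by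
    refine ((hy' j).mono le_rfl (hS.l_le j)).congr_deriv ?_
    filter_upwards [hK j] with t ht
    have hα := (hS.α_pos j).ne'
    simp only [r, hPdef]
    rw [← ht, inv_mul_cancel_left₀ hα, ell]
    ring
  have hderiv (j) : ∀ t ∈ Icc 0 (S.l j), derivWithin (y j) (Icc 0 (S.l j)) t = r j t := by
    intro t ht
    exact ((hyr j).hasDerivWithinAt (hr j).choose_spec.continuousOn ht).derivWithin
      (uniqueDiffOn_Icc (hS.l_pos j) t ht)
  have hell (j) : ∀ t ∈ Icc 0 (S.l j), S.ellReduced y j t = (S.α j)⁻¹ * P j t := by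
    intro t ht
    rw [ellReduced, hderiv j t ht]
    simp only [r]
    ring
  refine ⟨fun j => ⟨(hyr j).absolutelyContinuousOnInterval (hS.l_pos j).le,
    ((hr j).choose_spec.congr (hderiv j)).memW_one (hS.l_pos j).le⟩, fun j => ?_, hya, ?_⟩
  · filter_upwards [(hP j).ae_hasDerivAt, ae_restrict_mem measurableSet_Ioo] with t ht hmem
    have hloc : S.ell y j =ᶠ[nhds t] fun s => (S.α j)⁻¹ * P j s := by
      filter_upwards [Ioo_mem_nhds hmem.1 hmem.2] with s hs
      rw [hS.ell_eq_ellReduced y j hs.2, hell j s (Ioo_subset_Icc_self hs)]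
    have hα := (hS.α_pos j).ne'
    rw [operatorL, hloc.deriv_eq, (ht.const_mul _).deriv, neg_mul, mul_inv_cancel_left₀ hα,
      lowerOrder]
    ring
  · have hα (j) := mul_inv_cancel_left₀ (hS.α_pos j).ne'
    rw [hS.kirchhoff_eq hya.continuous_vertex, hell 0 (S.T 0) ⟨hS.T_zero_pos.le, le_rfl⟩, hα,
      Finset.sum_congr rfl fun j _ => by rw [hell j.succ 0 ⟨le_rfl, (hS.l_pos j.succ).le⟩, hα]]
    simp only [hPdef, intervalIntegral.integral_same, add_zero]
    rw [hK0, sub_self]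

theorem solvesIntegratedEuler_of_solvesBVP (hy : S.MemWGraph 1 y) (hy2 : S.MemWReduced 2 y)
    (h : S.SolvesBVP y) : S.SolvesIntegratedEuler y := by
  have hy' := fun j => (hy j).hasL2Deriv
  have hya := h.admissible
  have hp (j) : HasL2Deriv (fun t => S.α j * S.ellReduced y j t) (S.lowerOrder y j) 0 (S.l j) := by
    obtain ⟨d, hd⟩ := hS.hasL2Deriv_delayed hy' hya.continuous_vertex j
    have h₁ := (((MemW.hasL2Deriv (hy2 j).2).add
      (((hy' j).mono le_rfl (hS.l_le j)).const_mul (S.b j))).add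
      ((hd.mono le_rfl (hS.l_le j)).const_mul (S.c j)))
    refine (h₁.const_mul (S.α j)).congr_deriv ?_
    filter_upwards [h₁.ae_eq_deriv, h.equation j, ae_restrict_mem measurableSet_Ioo]
      with t ht heq hmem
    have hloc : S.ell y j =ᶠ[nhds t] fun s =>
        derivWithin (y j) (Icc 0 (S.l j)) s + S.b j * y j s + S.c j * S.delayed y j s := by
      filter_upwards [Iio_mem_nhds hmem.2] with s hs using hS.ell_eq_ellReduced y j hs
    rw [operatorL, hloc.deriv_eq] at heq
    rw [ht, lowerOrder]
    linarith
  refine ⟨fun j => S.α j * S.ellReduced y j 0, fun j => ?_, ?_⟩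
  · filter_upwards [ae_restrict_mem measurableSet_Ioo] with t ht
    rw [hS.ell_eq_ellReduced y j ht.2]
    exact (hp j).eq_add_integral t (Ioo_subset_Icc_self ht)
  · have hk := h.kirchhoff
    rw [hS.kirchhoff_eq hya.continuous_vertex, sub_eq_zero] at hk
    rw [← hk]
    exact ((hp 0).eq_add_integral (S.T 0) ⟨hS.T_zero_pos.le, le_rfl⟩).symm

end Proper

end PantographStar

theorem theorem2 {n : ℕ} (S : PantographStar n)
    (hq : 1 < S.q) (hT₁ : 0 < S.T 0)
    (hT : ∀ j : Fin n, (S.q - 1) * S.T 0 < S.T j.succ)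
    (hα : ∀ j, 0 < S.α j)
    (y : Fin (n + 1) → ℝ → ℝ) (hy : S.MemWGraph 1 y) :
    S.IsMinimizer y ↔ S.MemWReduced 2 y ∧ S.SolvesBVP y := by
  have hS : S.Proper := ⟨hq, hT₁, hT, hα⟩
  have hiff (hya : S.Admissible y) : S.IsMinimizer y ↔ S.SolvesIntegratedEuler y :=
    (hS.isMinimizer_iff hy hya).trans (hS.solvesIntegratedEuler_iff
      (hS.memLp_ell (fun j => (hy j).hasL2Deriv) hya.continuous_vertex)).symm
  constructor
  · intro h
    exact hS.solvesBVP_of_solvesIntegratedEuler hy h.2.1 ((hiff h.2.1).1 h)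
  · rintro ⟨hy2, h⟩
    exact (hiff h.admissible).2 (hS.solvesIntegratedEuler_of_solvesBVP hy hy2 h)
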